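/- Let $d\ge 2$ and $I^d=(0,1)^d$. For $\alpha>0$ and $n\ge 1$ let $\mathcal A(\alpha,n)$ be the class of all sets $\Sigma=\overline{I^d}\cap\bigcup_{i=1}^n \overline{B(x_i,r)}$ with $r=\alpha n^{-1/d}$ and centres $x_i$ in the $r$-neighbourhood of $I^d$. For such a $\Sigma$ let $u_\Sigma\in H^1_0(I^d\setminus\Sigma)$ be the weak solution of $-\Delta u=1$ in $I^d\setminus\Sigma$, $u=0$ on $\Sigma\cup\partial I^d$, that is, $$\int_{I^d}\nabla u_\Sigma\cdot\nabla\varphi\,dx=\int_{I^d}\varphi\,dx\quad\text{for all }\varphi\in H^1_0(I^d\setminus\Sigma),$$ and let $F(\Sigma)=\int_{I^d}u_\Sigma\,dx$. Define $$\theta(\alpha)=\inf\Big\{\liminf_{n\to\infty} n^{2/d}F(\Sigma_n)\ :\ \Sigma_n\in\mathcal A(\alpha,n)\text{ for all }n\ge1\Big\}.$$ Then there is a constant $C=C(d)$ such that for every $\alpha>0$ $$\theta(\alpha)\le C\,\alpha^{2-d}\quad\text{if }d\ge 3,\qquad \theta(\alpha)\le C\,\max\Big\{0,\ \log\frac{1}{\sqrt2\,\alpha}\Big\}\quad\text{if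 }d=2.$$ -/

import Mathlib

open MeasureTheory Filter Topology
open scoped ContDiff ENNReal

noncomputable section

namespace OptimalCompliance

/-- `MemH10 U u g`: the function `u`, extended by zero outside the open set `U`, belongs to
`H₀¹(U)`, and `g` is its weak gradient. That is, `(u, g)` is the limit in `L² × L²` of pairs
`(φ, ∇φ)` with `φ` smooth and compactly supported in `U`. For a given `u`, the field `g` is
unique up to null sets, and both `u` and `g` vanish almost everywhere outside `U`. -/
def MemH10 {d : ℕ} (U : Set (EuclideanSpace ℝ (Fin d))) (u : EuclideanSpace ℝ (Fin d) → ℝ)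
    (g : EuclideanSpace ℝ (Fin d) → EuclideanSpace ℝ (Fin d)) : Prop :=
  MemLp u 2 volume ∧ MemLp g 2 volume ∧
    ∃ φ : ℕ → EuclideanSpace ℝ (Fin d) → ℝ,
      (∀ k, ContDiff ℝ ∞ (φ k) ∧ HasCompactSupport (φ k) ∧ tsupport (φ k) ⊆ U) ∧
      Tendsto (fun k => eLpNorm (fun x => φ k x - u x) 2 volume) atTop (𝓝 0) ∧
      Tendsto (fun k => eLpNorm (fun x => gradient (φ k) x - g x) 2 volume) atTop (𝓝 0)

/-- `u` is the weak solution `u_{f,S,Ω}` of `-Δu = f` in `Ω \ S`, `u = 0` on `S ∪ ∂Ω`: it lies in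
`H₀¹(Ω \ S)` and `∫_Ω ∇u · ∇φ = ∫_Ω f φ` for every `φ ∈ H₀¹(Ω \ S)`. -/
def IsWeakSolution {d : ℕ} (f : EuclideanSpace ℝ (Fin d) → ℝ)
    (S Ω : Set (EuclideanSpace ℝ (Fin d))) (u : EuclideanSpace ℝ (Fin d) → ℝ) : Prop :=
  ∃ g : EuclideanSpace ℝ (Fin d) → EuclideanSpace ℝ (Fin d), MemH10 (Ω \ S) u g ∧
    ∀ (φ : EuclideanSpace ℝ (Fin d) → ℝ)
      (ψ : EuclideanSpace ℝ (Fin d) → EuclideanSpace ℝ (Fin d)),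
      MemH10 (Ω \ S) φ ψ → ∫ x in Ω, inner ℝ (g x) (ψ x) = ∫ x in Ω, f x * φ x

/-- The compliance `F(S, f, Ω) = ∫_Ω f u`, where `u` is the weak solution `u_{f,S,Ω}`. The
solution is unique up to null sets, so that the infimum runs over a single value; the value
would be `⊤` only if there were no solution. -/
def compliance {d : ℕ} (S : Set (EuclideanSpace ℝ (Fin d))) (f : EuclideanSpace ℝ (Fin d) → ℝ)
    (Ω : Set (EuclideanSpace ℝ (Fin d))) : EReal :=
  ⨅ (u : EuclideanSpace ℝ (Fin d) → ℝ) (_ : IsWeakSolution f S Ω u),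
    ((∫ x in Ω, f x * u x : ℝ) : EReal)

/-- The radius `α n^{-1/d}`. -/
def radius (d : ℕ) (α : ℝ) (n : ℕ) : ℝ := α * (n : ℝ) ^ (-1 / (d : ℝ))

/-- The class `𝒜(α, n)(Ω)`: the traces on the closure of `Ω` of unions of `n` closed balls of
radius `r = α n^{-1/d}` with centres in the `r`-neighbourhood of `Ω`. -/
def admissible {d : ℕ} (α : ℝ) (n : ℕ) (Ω : Set (EuclideanSpace ℝ (Fin d))) :
    Set (Set (EuclideanSpace ℝ (Fin d))) :=
  {S | ∃ x : Fin n → EuclideanSpace ℝ (Fin d),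
    (∀ i, x i ∈ Metric.thickening (radius d α n) Ω) ∧
    S = closure Ω ∩ ⋃ i, Metric.closedBall (x i) (radius d α n)}

/-- The open unit cube `(0,1)^d`. -/
def unitCube (d : ℕ) : Set (EuclideanSpace ℝ (Fin d)) :=
  {x | ∀ i, x i ∈ Set.Ioo (0 : ℝ) 1}

/-- `θ(α) = inf { liminf_n n^{2/d} F(S_n, 1, (0,1)^d) : S_n ∈ 𝒜(α, n)((0,1)^d) }`, with values in
the extended reals. -/
def theta (d : ℕ) (α : ℝ) : EReal :=
  sInf {L : EReal | ∃ S : ℕ → Set (EuclideanSpace ℝ (Fin d)),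
    (∀ n : ℕ, 0 < n → S n ∈ admissible α n (unitCube d)) ∧
    L = liminf (fun n : ℕ => (((n : ℝ) ^ (2 / (d : ℝ)) : ℝ) : EReal) *
      compliance (S n) (fun _ => 1) (unitCube d)) atTop}

end OptimalCompliance

end

/-!
For `n = m ^ d`, place the balls at the centres of the cells of the regular grid with `m` cells in
each direction. On a cell `Q`, write a function vanishing on the central ball as the integral of its
gradient along rays from the centre; exchanging the integrals and applying Cauchy–Schwarz against
the resulting radial weight gives `(∫_Q |φ|)² ≤ κ ∫_Q |∇φ|²`. Summing over the cells yields
`(∫ φ)² ≤ m ^ d * κ * ∫ |∇φ|²` on `H₀¹`, and testing the equation with its own solution turns this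
into the bound `m ^ d * κ` for the compliance. Rescaling a cell to side `1` multiplies `κ` by
`m ^ (d + 2)`, so that `n ^ (2 / d)` times the bound does not depend on `m`: it is a multiple of
`∫ s ^ (1 - d) ds` over `[α, √d / 2]`, which is at most `α ^ (2 - d)` for `d ≥ 3` and a logarithm
for `d = 2`.
-/

noncomputable section

namespace OptimalCompliance

section TestFunctions

/-- Test functions on `U`: the smooth functions with compact support contained in `U`. -/
structure IsTestFunction {E : Type*} [NormedAddCommGroup E] [NormedSpace ℝ E] (U : Set E)
    (φ : E → ℝ) : Prop where
  contDiff : ContDiff ℝ ∞ φ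
  hasCompactSupport : HasCompactSupport φ
  tsupport_subset : tsupport φ ⊆ U

namespace IsTestFunction

section NormedSpace

variable {E : Type*} [NormedAddCommGroup E] [NormedSpace ℝ E] {U : Set E} {φ ψ : E → ℝ}

theorem contDiff_one (hφ : IsTestFunction U φ) : ContDiff ℝ 1 φ :=
  hφ.contDiff.of_le (mod_cast le_top)

theorem eq_zero_of_notMem (hφ : IsTestFunction U φ) {x : E} (hx : x ∉ U) : φ x = 0 :=
  image_eq_zero_of_notMem_tsupport fun h ↦ hx (hφ.tsupport_subset h)

theorem zero : IsTestFunction U (0 : E → ℝ) where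
  contDiff := contDiff_const
  hasCompactSupport := .zero
  tsupport_subset := by simp [tsupport]

theorem add (hφ : IsTestFunction U φ) (hψ : IsTestFunction U ψ) : IsTestFunction U (φ + ψ) where
  contDiff := hφ.contDiff.add hψ.contDiff
  hasCompactSupport := hφ.hasCompactSupport.add hψ.hasCompactSupport
  tsupport_subset :=
    (tsupport_add φ ψ).trans (Set.union_subset hφ.tsupport_subset hψ.tsupport_subset)

theorem const_smul (c : ℝ) (hφ : IsTestFunction U φ) : IsTestFunction U (c • φ) where
  contDiff := hφ.contDiff.const_smul c
  hasCompactSupport := hφ.hasCompactSupport.smul_left (f := fun _ ↦ c)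
  tsupport_subset := (tsupport_smul_subset_right (fun _ ↦ c) φ).trans hφ.tsupport_subset

theorem memLp [MeasurableSpace E] [BorelSpace E] {μ : Measure E} [IsFiniteMeasureOnCompacts μ]
    (hφ : IsTestFunction U φ) : MemLp φ 2 μ :=
  hφ.contDiff.continuous.memLp_of_hasCompactSupport hφ.hasCompactSupport

end NormedSpace

section InnerProductSpace

variable {E : Type*} [NormedAddCommGroup E] [InnerProductSpace ℝ E] [CompleteSpace E] {U : Set E}
  {φ ψ : E → ℝ}

theorem hasGradientAt (hφ : IsTestFunction U φ) (x : E) : HasGradientAt φ (gradient φ x) x :=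
  (hφ.contDiff_one.differentiable one_ne_zero x).hasGradientAt

theorem gradient_add (hφ : IsTestFunction U φ) (hψ : IsTestFunction U ψ) :
    gradient (φ + ψ) = gradient φ + gradient ψ := by
  ext1 x
  refine HasGradientAt.gradient ?_
  rw [hasGradientAt_iff_hasFDerivAt, Pi.add_apply, map_add]
  exact (hφ.hasGradientAt x).hasFDerivAt.add (hψ.hasGradientAt x).hasFDerivAt

theorem gradient_const_smul (c : ℝ) (hφ : IsTestFunction U φ) :
    gradient (c • φ) = c • gradient φ := by
  ext1 x
  refine HasGradientAt.gradient ?_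
  rw [hasGradientAt_iff_hasFDerivAt, Pi.smul_apply, map_smul]
  exact (hφ.hasGradientAt x).hasFDerivAt.const_smul c

theorem continuous_gradient (hφ : IsTestFunction U φ) : Continuous (gradient φ) :=
  (LinearIsometryEquiv.continuous _).comp (hφ.contDiff_one.continuous_fderiv one_ne_zero)

theorem hasCompactSupport_gradient (hφ : IsTestFunction U φ) : HasCompactSupport (gradient φ) :=
  (hφ.hasCompactSupport.fderiv ℝ).comp_left (map_zero (InnerProductSpace.toDual ℝ E).symm)

theorem gradient_eq_zero_of_notMem (hφ : IsTestFunction U φ) {x : E} (hx : x ∉ U) :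
    gradient φ x = 0 := by
  have h : fderiv ℝ φ x = 0 := image_eq_zero_of_notMem_tsupport fun h ↦
    hx (hφ.tsupport_subset (tsupport_fderiv_subset ℝ h))
  rw [gradient, h, map_zero]

theorem memLp_gradient [MeasurableSpace E] [BorelSpace E] {μ : Measure E}
    [IsFiniteMeasureOnCompacts μ] (hφ : IsTestFunction U φ) : MemLp (gradient φ) 2 μ :=
  hφ.continuous_gradient.memLp_of_hasCompactSupport hφ.hasCompactSupport_gradient

end InnerProductSpace

end IsTestFunction

theorem norm_gradient {E : Type*} [NormedAddCommGroup E] [InnerProductSpace ℝ E] [CompleteSpace E]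
    (f : E → ℝ) (x : E) : ‖gradient f x‖ = ‖fderiv ℝ f x‖ :=
  LinearIsometryEquiv.norm_map _ _

end TestFunctions

section SobolevSpace

variable {d : ℕ} {U Ω : Set (EuclideanSpace ℝ (Fin d))} {φ u : EuclideanSpace ℝ (Fin d) → ℝ}
  {g : EuclideanSpace ℝ (Fin d) → EuclideanSpace ℝ (Fin d)}

/-- The Hilbert space `L²(ℝᵈ) × L²(ℝᵈ; ℝᵈ)` of pairs of a function and a vector field. -/
abbrev L2Pair (d : ℕ) : Type :=
  WithLp 2 (Lp ℝ 2 (volume : Measure (EuclideanSpace ℝ (Fin d))) ×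
    Lp (EuclideanSpace ℝ (Fin d)) 2 (volume : Measure (EuclideanSpace ℝ (Fin d))))

/-- The pair `(φ, ∇φ)` of a test function `φ`, as an element of `L² × L²`. -/
def IsTestFunction.toL2Pair (hφ : IsTestFunction U φ) : L2Pair d :=
  WithLp.toLp 2 (hφ.memLp.toLp φ, hφ.memLp_gradient.toLp (gradient φ))

/-- The graph of the gradient on test functions: the pairs `(φ, ∇φ)` with `φ` a test function
on `U`. -/
def gradientGraph (U : Set (EuclideanSpace ℝ (Fin d))) : Submodule ℝ (L2Pair d) where
  carrier := {p | ∃ φ, ∃ hφ : IsTestFunction U φ, hφ.toL2Pair = p}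
  zero_mem' := by
    refine ⟨0, .zero, ?_⟩
    have h : gradient (0 : EuclideanSpace ℝ (Fin d) → ℝ) = 0 := gradient_fun_const' 0
    simp only [IsTestFunction.toL2Pair, h]
    rfl
  add_mem' := by
    rintro _ _ ⟨φ, hφ, rfl⟩ ⟨ψ, hψ, rfl⟩
    refine ⟨φ + ψ, hφ.add hψ, ?_⟩
    simp only [IsTestFunction.toL2Pair, hφ.gradient_add hψ]
    rfl
  smul_mem' := by
    rintro c _ ⟨φ, hφ, rfl⟩
    refine ⟨c • φ, hφ.const_smul c, ?_⟩
    simp only [IsTestFunction.toL2Pair, hφ.gradient_const_smul c]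
    rfl

/-- The Sobolev space `H₀¹(U)`, realised as the space of the pairs `(u, ∇u)`: the closure of the
graph of the gradient in `L² × L²`. -/
def sobolevH10 (U : Set (EuclideanSpace ℝ (Fin d))) : Submodule ℝ (L2Pair d) :=
  (gradientGraph U).topologicalClosure

instance : CompleteSpace (sobolevH10 U) :=
  (Submodule.isClosed_topologicalClosure _).completeSpace_coe

theorem memH10_of_mem_sobolevH10 {p : L2Pair d} (hp : p ∈ sobolevH10 U) :
    MemH10 U p.fst p.snd := by
  obtain ⟨q, hq, hlim⟩ := mem_closure_iff_seq_limit.1 hp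
  choose φ hφ hφq using hq
  obtain rfl : (fun k ↦ (hφ k).toL2Pair) = q := funext hφq
  refine ⟨Lp.memLp _, Lp.memLp _, φ,
    fun k ↦ ⟨(hφ k).contDiff, (hφ k).hasCompactSupport, (hφ k).tsupport_subset⟩, ?_, ?_⟩
  · refine (Lp.tendsto_Lp_iff_tendsto_eLpNorm'' _ (fun k ↦ (hφ k).memLp) _ (Lp.memLp _)).1 ?_
    rw [Lp.toLp_coeFn]
    exact ((WithLp.fstL 2 ℝ _ _).continuous.tendsto p).comp hlim
  · refine (Lp.tendsto_Lp_iff_tendsto_eLpNorm'' _ (fun k ↦ (hφ k).memLp_gradient) _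
      (Lp.memLp _)).1 ?_
    rw [Lp.toLp_coeFn]
    exact ((WithLp.sndL 2 ℝ _ _).continuous.tendsto p).comp hlim

theorem MemH10.exists_mem_sobolevH10 (h : MemH10 U u g) :
    ∃ p ∈ sobolevH10 U, p.fst =ᵐ[volume] u ∧ p.snd =ᵐ[volume] g := by
  obtain ⟨hu, hg, φ, hφ, hφu, hφg⟩ := h
  have hφ (k : ℕ) : IsTestFunction U (φ k) := ⟨(hφ k).1, (hφ k).2.1, (hφ k).2.2⟩
  refine ⟨WithLp.toLp 2 (hu.toLp u, hg.toLp g), ?_, hu.coeFn_toLp, hg.coeFn_toLp⟩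
  refine mem_closure_iff_seq_limit.2 ⟨fun k ↦ (hφ k).toL2Pair, fun k ↦ ⟨φ k, hφ k, rfl⟩, ?_⟩
  refine ((WithLp.prod_continuous_toLp 2 _ _).tendsto _).comp (Tendsto.prodMk_nhds ?_ ?_)
  · exact (Lp.tendsto_Lp_iff_tendsto_eLpNorm'' _ (fun k ↦ (hφ k).memLp) _ hu).2 hφu
  · exact (Lp.tendsto_Lp_iff_tendsto_eLpNorm'' _ (fun k ↦ (hφ k).memLp_gradient) _ hg).2 hφg

theorem MemH10.gradient_ae_eq_zero_of_notMem (hΩ : MeasurableSet Ω) (hU : U ⊆ Ω)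
    (h : MemH10 U u g) : ∀ᵐ x, x ∉ Ω → g x = 0 := by
  obtain ⟨-, hg, φ, hφ, -, hφg⟩ := h
  have hφ (k : ℕ) : IsTestFunction U (φ k) := ⟨(hφ k).1, (hφ k).2.1, (hφ k).2.2⟩
  have hle (k : ℕ) : eLpNorm g 2 (volume.restrict Ωᶜ) ≤
      eLpNorm (fun x ↦ gradient (φ k) x - g x) 2 volume := by
    refine le_trans (le_of_eq (eLpNorm_congr_norm_ae ?_))
      (eLpNorm_mono_measure _ (Measure.restrict_le_self (s := Ωᶜ)))
    filter_upwards [ae_restrict_mem hΩ.compl] with x hx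
    rw [(hφ k).gradient_eq_zero_of_notMem fun h ↦ hx (hU h), zero_sub, norm_neg]
  have hzero : eLpNorm g 2 (volume.restrict Ωᶜ) = 0 :=
    le_antisymm (ge_of_tendsto' hφg hle) zero_le
  rw [eLpNorm_eq_zero_iff hg.1.restrict two_ne_zero] at hzero
  exact (ae_restrict_iff' hΩ.compl).1 hzero

theorem MemH10.setIntegral_inner_gradient (hΩ : MeasurableSet Ω) (hU : U ⊆ Ω) (h : MemH10 U u g)
    (ψ : EuclideanSpace ℝ (Fin d) → EuclideanSpace ℝ (Fin d)) :
    ∫ x in Ω, inner ℝ (g x) (ψ x) = ∫ x, inner ℝ (g x) (ψ x) := by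
  refine setIntegral_eq_integral_of_ae_compl_eq_zero ?_
  filter_upwards [h.gradient_ae_eq_zero_of_notMem hΩ hU] with x hx hxΩ
  rw [hx hxΩ, inner_zero_left]

end SobolevSpace

section EnergyInequalities

theorem sq_lintegral_mul_le {α : Type*} [MeasurableSpace α] {μ : Measure α} {f g : α → ℝ≥0∞}
    (hf : AEMeasurable f μ) (hg : AEMeasurable g μ) :
    (∫⁻ x, f x * g x ∂μ) ^ 2 ≤ (∫⁻ x, f x ^ 2 ∂μ) * ∫⁻ x, g x ^ 2 ∂μ := by
  have h := ENNReal.rpow_le_rpow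
    (ENNReal.lintegral_mul_le_Lp_mul_Lq μ Real.HolderConjugate.two_two hf hg) zero_le_two
  rw [ENNReal.mul_rpow_of_nonneg _ _ zero_le_two, ← ENNReal.rpow_mul, ← ENNReal.rpow_mul] at h
  norm_num at h
  exact h

theorem ofReal_integral_norm_sq {α F : Type*} [MeasurableSpace α] [NormedAddCommGroup F]
    {μ : Measure α} {g : α → F} (hg : MemLp g 2 μ) :
    ENNReal.ofReal (∫ x, ‖g x‖ ^ 2 ∂μ) = ∫⁻ x, ‖g x‖ₑ ^ 2 ∂μ := by
  rw [ofReal_integral_eq_lintegral_ofReal (hg.integrable_norm_pow two_ne_zero)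
    (ae_of_all _ fun _ ↦ by positivity)]
  simp only [ENNReal.ofReal_pow (norm_nonneg _), ofReal_norm]

variable {E F : Type*} [NormedAddCommGroup E] [NormedSpace ℝ E] [NormedAddCommGroup F]
  [NormedSpace ℝ F] {f : E → F}

theorem enorm_sub_le_lintegral_fderiv (hf : ContDiff ℝ 1 f) (x v : E) :
    ‖f (x + v) - f x‖ₑ ≤ ∫⁻ t in Set.Ioc (0 : ℝ) 1, ‖v‖ₑ * ‖fderiv ℝ f (x + t • v)‖ₑ := by
  have hderiv (t : ℝ) : HasDerivAt (fun t : ℝ ↦ f (x + t • v)) (fderiv ℝ f (x + t • v) v) t :=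
    (hf.differentiable one_ne_zero _).hasFDerivAt.comp_hasDerivAt t
      (by simpa using ((hasDerivAt_id t).smul_const v).const_add x)
  have hle := enorm_sub_le_lintegral_deriv_of_contDiffOn_Icc (f := fun t : ℝ ↦ f (x + t • v))
    (a := 0) (b := 1) (by fun_prop) zero_le_one
  simp only [one_smul, zero_smul, add_zero, ← restrict_Ioc_eq_restrict_Icc, (hderiv _).deriv] at hle
  refine hle.trans (lintegral_mono fun t ↦ ?_)
  rw [mul_comm]
  exact ContinuousLinearMap.le_opENorm _ _

theorem lintegral_enorm_sq_le_of_translate [FiniteDimensional ℝ E] [MeasurableSpace E]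
    [BorelSpace E] (μ : Measure E) [μ.IsAddHaarMeasure] (hf : ContDiff ℝ 1 f) {e : E}
    (he : ∀ x, f x = 0 ∨ f (x + e) = 0) :
    ∫⁻ x, ‖f x‖ₑ ^ 2 ∂μ ≤ ‖e‖ₑ ^ 2 * ∫⁻ x, ‖fderiv ℝ f x‖ₑ ^ 2 ∂μ := by
  have := hf.continuous_fderiv one_ne_zero
  have hpoint (x : E) : ‖f x‖ₑ ^ 2 ≤
      ‖e‖ₑ ^ 2 * ∫⁻ t in Set.Ioc (0 : ℝ) 1, ‖fderiv ℝ f (x + t • e)‖ₑ ^ 2 := by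
    rcases he x with hx | hx
    · simp [hx]
    · calc ‖f x‖ₑ ^ 2 = ‖f (x + e) - f x‖ₑ ^ 2 := by rw [hx, zero_sub, enorm_neg]
        _ ≤ (∫⁻ t in Set.Ioc (0 : ℝ) 1, ‖e‖ₑ * ‖fderiv ℝ f (x + t • e)‖ₑ) ^ 2 := by
          gcongr; exact enorm_sub_le_lintegral_fderiv hf x e
        _ ≤ _ := sq_lintegral_mul_le aemeasurable_const (by fun_prop)
        _ = _ := by simp
  calc ∫⁻ x, ‖f x‖ₑ ^ 2 ∂μ
      ≤ ∫⁻ x, ‖e‖ₑ ^ 2 * (∫⁻ t in Set.Ioc (0 : ℝ) 1, ‖fderiv ℝ f (x + t • e)‖ₑ ^ 2) ∂μ :=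
        lintegral_mono hpoint
    _ = ‖e‖ₑ ^ 2 * ∫⁻ t in Set.Ioc (0 : ℝ) 1, ∫⁻ x, ‖fderiv ℝ f (x + t • e)‖ₑ ^ 2 ∂μ := by
        rw [lintegral_const_mul' _ _ (by simp), lintegral_lintegral_swap]
        exact Continuous.aemeasurable (by fun_prop)
    _ = ‖e‖ₑ ^ 2 * ∫⁻ x, ‖fderiv ℝ f x‖ₑ ^ 2 ∂μ := by
        simp only [lintegral_add_right_eq_self fun x ↦ ‖fderiv ℝ f x‖ₑ ^ 2, setLIntegral_const,
          Real.volume_Ioc, sub_zero, ENNReal.ofReal_one, mul_one]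

theorem exists_poincare_const {E : Type*} [NormedAddCommGroup E] [InnerProductSpace ℝ E]
    [FiniteDimensional ℝ E] [Nontrivial E] [MeasurableSpace E] [BorelSpace E] (μ : Measure E)
    [μ.IsAddHaarMeasure] {U : Set E} (hU : Bornology.IsBounded U) :
    ∃ P : ℝ, 0 ≤ P ∧ ∀ φ, IsTestFunction U φ →
      ∫ x, ‖φ x‖ ^ 2 ∂μ ≤ P * ∫ x, ‖gradient φ x‖ ^ 2 ∂μ := by
  obtain ⟨R, hR⟩ := hU.exists_norm_le
  obtain ⟨e, he⟩ := exists_norm_eq E (c := 2 * |R| + 1) (by positivity)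
  have hmove (x : E) : x ∉ U ∨ x + e ∉ U := by
    by_contra! h
    have := norm_sub_le (x + e) x
    rw [add_sub_cancel_left, he] at this
    linarith [hR _ h.1, hR _ h.2, le_abs_self R]
  refine ⟨‖e‖ ^ 2, by positivity, fun φ hφ ↦ ?_⟩
  rw [← ENNReal.ofReal_le_ofReal_iff (by positivity), ENNReal.ofReal_mul (by positivity),
    ofReal_integral_norm_sq hφ.memLp, ofReal_integral_norm_sq hφ.memLp_gradient,
    ENNReal.ofReal_pow (norm_nonneg _), ofReal_norm]
  simp only [← ofReal_norm (gradient φ _), norm_gradient, ofReal_norm]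
  exact lintegral_enorm_sq_le_of_translate μ hφ.contDiff_one fun x ↦
    (hmove x).imp hφ.eq_zero_of_notMem hφ.eq_zero_of_notMem

end EnergyInequalities

section WeakSolution

theorem exists_forall_inner_map_eq {V F : Type*} [NormedAddCommGroup V] [InnerProductSpace ℝ V]
    [CompleteSpace V] [NormedAddCommGroup F] [InnerProductSpace ℝ F] (T : V →L[ℝ] F) {c : ℝ}
    (hc : 0 < c) (hT : ∀ v, c * ‖v‖ ^ 2 ≤ ‖T v‖ ^ 2) (ℓ : V →L[ℝ] ℝ) :
    ∃ w, ∀ v, inner ℝ (T w) (T v) = ℓ v := by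
  let B : V →L[ℝ] V →L[ℝ] ℝ := (innerSL ℝ).bilinearComp T T
  have hB (v w : V) : B v w = inner ℝ (T v) (T w) := rfl
  have hcoercive : IsCoercive B := ⟨c, hc, fun v ↦ by
    rw [hB, real_inner_self_eq_norm_sq, mul_assoc, ← sq]
    exact hT v⟩
  refine ⟨hcoercive.continuousLinearEquivOfBilin.symm ((InnerProductSpace.toDual ℝ V).symm ℓ),
    fun v ↦ ?_⟩
  rw [← hB, ← hcoercive.continuousLinearEquivOfBilin_apply,
    ContinuousLinearEquiv.apply_symm_apply, InnerProductSpace.toDual_symm_apply]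

theorem norm_toLp_sq {α F : Type*} [MeasurableSpace α] [NormedAddCommGroup F]
    [InnerProductSpace ℝ F] {μ : Measure α} {g : α → F} (hg : MemLp g 2 μ) :
    ‖hg.toLp g‖ ^ 2 = ∫ x, ‖g x‖ ^ 2 ∂μ := by
  rw [← real_inner_self_eq_norm_sq, L2.inner_def]
  refine integral_congr_ae ?_
  filter_upwards [hg.coeFn_toLp] with x hx
  rw [hx, real_inner_self_eq_norm_sq]

variable {d : ℕ} {U S Ω : Set (EuclideanSpace ℝ (Fin d))} {f : EuclideanSpace ℝ (Fin d) → ℝ}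

theorem le_mul_norm_snd_sq_of_mem_sobolevH10 {N : L2Pair d → ℝ} (hN : Continuous N) {K : ℝ}
    (h : ∀ φ, ∀ hφ : IsTestFunction U φ, N hφ.toL2Pair ≤ K * ∫ x, ‖gradient φ x‖ ^ 2)
    {p : L2Pair d} (hp : p ∈ sobolevH10 U) : N p ≤ K * ‖p.snd‖ ^ 2 := by
  refine closure_minimal (t := {p | N p ≤ K * ‖p.snd‖ ^ 2}) ?_ ?_ hp
  · rintro _ ⟨φ, hφ, rfl⟩
    exact (h φ hφ).trans_eq (congrArg (K * ·) (norm_toLp_sq hφ.memLp_gradient).symm)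
  · exact isClosed_le hN (continuous_const.mul ((WithLp.sndL 2 ℝ _ _).continuous.norm.pow 2))

/-- The load `v ↦ ∫_Ω f v`, as a bounded functional on `L²`. -/
def load (hf : MemLp f 2 (volume.restrict Ω)) :
    Lp ℝ 2 (volume : Measure (EuclideanSpace ℝ (Fin d))) →L[ℝ] ℝ :=
  (innerSL ℝ (hf.toLp f)).comp (LpToLpRestrictCLM _ ℝ ℝ volume 2 Ω)

theorem load_apply (hf : MemLp f 2 (volume.restrict Ω))
    {v : Lp ℝ 2 (volume : Measure (EuclideanSpace ℝ (Fin d)))} {u : EuclideanSpace ℝ (Fin d) → ℝ}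
    (hv : v =ᵐ[volume] u) : load hf v = ∫ x in Ω, f x * u x := by
  rw [load, ContinuousLinearMap.comp_apply, innerSL_apply_apply, L2.inner_def]
  refine integral_congr_ae ?_
  filter_upwards [hf.coeFn_toLp, LpToLpRestrictCLM_coeFn ℝ Ω v, ae_restrict_of_ae hv]
    with x hfx hvx hux
  rw [hfx, hvx, hux, RCLike.inner_apply', conj_trivial]

theorem exists_isWeakSolution (hΩ : MeasurableSet Ω) (hf : MemLp f 2 (volume.restrict Ω)) {P : ℝ}
    (hP0 : 0 ≤ P)
    (hP : ∀ φ, IsTestFunction (Ω \ S) φ → ∫ x, ‖φ x‖ ^ 2 ≤ P * ∫ x, ‖gradient φ x‖ ^ 2) :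
    ∃ p ∈ sobolevH10 (Ω \ S), IsWeakSolution f S Ω p.fst ∧ load hf p.fst = ‖p.snd‖ ^ 2 := by
  let grad := (WithLp.sndL 2 ℝ (Lp ℝ 2 (volume : Measure (EuclideanSpace ℝ (Fin d)))) _).comp
    (sobolevH10 (Ω \ S)).subtypeL
  have hpoincare {p : L2Pair d} (hp : p ∈ sobolevH10 (Ω \ S)) :
      ‖p.fst‖ ^ 2 ≤ P * ‖p.snd‖ ^ 2 :=
    le_mul_norm_snd_sq_of_mem_sobolevH10 (N := fun p ↦ ‖p.fst‖ ^ 2)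
      ((WithLp.fstL 2 ℝ _ _).continuous.norm.pow 2)
      (fun φ hφ ↦ (norm_toLp_sq hφ.memLp).trans_le (hP φ hφ)) hp
  have hcoercive (p : sobolevH10 (Ω \ S)) : (1 + P)⁻¹ * ‖p‖ ^ 2 ≤ ‖grad p‖ ^ 2 := by
    rw [inv_mul_le_iff₀ (by positivity), add_mul, one_mul, add_comm]
    calc ‖p‖ ^ 2 = ‖p.1.fst‖ ^ 2 + ‖p.1.snd‖ ^ 2 := WithLp.prod_norm_sq_eq_of_L2 p.1
      _ ≤ P * ‖p.1.snd‖ ^ 2 + ‖p.1.snd‖ ^ 2 := by gcongr; exact hpoincare p.2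
  obtain ⟨⟨p, hp⟩, hweak⟩ := exists_forall_inner_map_eq grad (by positivity) hcoercive
    ((load hf).comp ((WithLp.fstL 2 ℝ _ _).comp (sobolevH10 (Ω \ S)).subtypeL))
  have hmem := memH10_of_mem_sobolevH10 hp
  refine ⟨p, hp, ⟨p.snd, hmem, fun φ ψ hφ ↦ ?_⟩, ?_⟩
  · obtain ⟨q, hq, hqφ, hqψ⟩ := hφ.exists_mem_sobolevH10
    calc ∫ x in Ω, inner ℝ (p.snd x) (ψ x) = ∫ x, inner ℝ (p.snd x) (ψ x) :=
          hmem.setIntegral_inner_gradient hΩ Set.sdiff_subset ψ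
      _ = ∫ x, inner ℝ (p.snd x) (q.snd x) := by
          refine integral_congr_ae ?_
          filter_upwards [hqψ] with x hx
          rw [hx]
      _ = inner ℝ p.snd q.snd := (L2.inner_def _ _).symm
      _ = load hf q.fst := hweak ⟨q, hq⟩
      _ = ∫ x in Ω, f x * φ x := load_apply hf hqφ
  · exact (hweak ⟨p, hp⟩).symm.trans (real_inner_self_eq_norm_sq _)

/-- Testing the equation with its solution `u` gives `∫ f u = ∫ |∇u|²`, whence
`(∫ f u)² ≤ K ∫ |∇u|² = K ∫ f u`. -/
theorem compliance_le [NeZero d] (hΩ : MeasurableSet Ω) (hbdd : Bornology.IsBounded Ω)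
    (hf : MemLp f 2 (volume.restrict Ω)) {K : ℝ} (hK0 : 0 ≤ K)
    (hK : ∀ φ, IsTestFunction (Ω \ S) φ →
      (∫ x in Ω, f x * φ x) ^ 2 ≤ K * ∫ x, ‖gradient φ x‖ ^ 2) :
    compliance S f Ω ≤ K := by
  obtain ⟨P, hP0, hP⟩ := exists_poincare_const (U := Ω \ S)
    (volume : Measure (EuclideanSpace ℝ (Fin d))) (hbdd.subset Set.sdiff_subset)
  obtain ⟨p, hp, hsol, henergy⟩ := exists_isWeakSolution hΩ hf hP0 hP
  have hbound : load hf p.fst ^ 2 ≤ K * ‖p.snd‖ ^ 2 :=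
    le_mul_norm_snd_sq_of_mem_sobolevH10 (N := fun p ↦ load hf p.fst ^ 2)
      (((load hf).continuous.comp (WithLp.fstL 2 ℝ _ _).continuous).pow 2)
      (fun φ hφ ↦ by
        have hload : load hf hφ.toL2Pair.fst = ∫ x in Ω, f x * φ x :=
          load_apply hf hφ.memLp.coeFn_toLp
        simpa only [hload] using hK φ hφ) hp
  refine (iInf₂_le _ hsol).trans (EReal.coe_le_coe ?_)
  rw [← load_apply hf (EventuallyEq.refl _ _)]
  nlinarith

end WeakSolution

section RadialIntegration

variable {E : Type*} [NormedAddCommGroup E] [NormedSpace ℝ E] [FiniteDimensional ℝ E]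
  [MeasurableSpace E] [BorelSpace E] (μ : Measure E) [μ.IsAddHaarMeasure]

theorem setLIntegral_closedBall_comp_smul {G : E → ℝ≥0∞} (hG : Measurable G) {t : ℝ} (ht : 0 < t)
    (ρ : ℝ) : ∫⁻ x in Metric.closedBall 0 ρ, G (t • x) ∂μ =
      ENNReal.ofReal (t ^ Module.finrank ℝ E)⁻¹ * ∫⁻ y in Metric.closedBall 0 (t * ρ), G y ∂μ := by
  have hpre : Metric.closedBall (0 : E) ρ = (t • ·) ⁻¹' Metric.closedBall 0 (t * ρ) := by
    ext x
    simp [norm_smul, abs_of_pos ht, ht]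
  rw [hpre, ← setLIntegral_map Metric.isClosed_closedBall.measurableSet hG
    (measurable_const_smul t), Measure.map_addHaar_smul μ ht.ne', Measure.restrict_smul,
    lintegral_smul_measure, smul_eq_mul, abs_of_pos (by positivity)]

theorem lintegral_Ici_inv_pow_succ {n : ℕ} (hn : n ≠ 0) {a : ℝ} (ha : 0 < a) :
    ∫⁻ t in Set.Ici a, ENNReal.ofReal (t ^ (n + 1))⁻¹ = ENNReal.ofReal ((a ^ n)⁻¹ / n) := by
  have hlt : -((n : ℝ) + 1) < -1 := by simpa using Nat.pos_of_ne_zero hn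
  have hpow {t : ℝ} (ht : t ∈ Set.Ioi a) : (t ^ (n + 1))⁻¹ = t ^ (-((n : ℝ) + 1)) := by
    rw [Real.rpow_neg (ha.trans ht).le, ← Nat.cast_add_one, Real.rpow_natCast]
  rw [← restrict_Ioi_eq_restrict_Ici,
    setLIntegral_congr_fun measurableSet_Ioi fun t ht ↦ congrArg ENNReal.ofReal (hpow ht),
    ← ofReal_integral_eq_lintegral_ofReal (integrableOn_Ioi_rpow_of_lt hlt ha)
      ((ae_restrict_iff' measurableSet_Ioi).2 (ae_of_all _ fun t ht ↦
        Real.rpow_nonneg (ha.trans ht).le _)),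
    integral_Ioi_rpow_of_lt hlt ha, neg_add, neg_add_cancel_right, neg_div_neg_eq,
    Real.rpow_neg ha.le, Real.rpow_natCast]

/-- The part of the integral of `t⁻⁽ⁿ⁺¹⁾` over rays that reaches the distance `s`: the integrand is
the Jacobian `t⁻ⁿ` of `x ↦ t • x` times the factor `t⁻¹` from `‖x‖ = t⁻¹ * ‖t • x‖`, and the
points at distance `s` lie in the image of the ball of radius `ρ` when `s ≤ t * ρ`. -/
def rayKernel (n : ℕ) (ρ s t : ℝ) : ℝ≥0∞ :=
  {t : ℝ | s ≤ t * ρ}.indicator (fun t ↦ ENNReal.ofReal (t ^ (n + 1))⁻¹) t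

theorem measurable_rayKernel (n : ℕ) (ρ : ℝ) :
    Measurable fun p : ℝ × ℝ ↦ rayKernel n ρ p.1 p.2 :=
  Measurable.indicator (s := {p : ℝ × ℝ | p.1 ≤ p.2 * ρ})
    (f := fun p ↦ ENNReal.ofReal (p.2 ^ (n + 1))⁻¹) (by fun_prop)
    (measurableSet_le (by fun_prop) (by fun_prop))

/-- The weight with which a point at distance `s` from the origin is counted when the rays from the
origin to all points of the ball of radius `ρ` are integrated. -/
def rayWeight (n : ℕ) (ρ s : ℝ) : ℝ := ρ ^ n / n * (s ^ (n - 1))⁻¹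

theorem mul_lintegral_rayKernel_le {n : ℕ} (hn : n ≠ 0) {ρ s : ℝ} (hρ : 0 < ρ) (hs : 0 ≤ s) :
    ENNReal.ofReal s * ∫⁻ t in Set.Ioc 0 1, rayKernel n ρ s t ≤
      ENNReal.ofReal (rayWeight n ρ s) := by
  rcases hs.eq_or_lt with rfl | hs
  · simp
  have hset : {t : ℝ | s ≤ t * ρ} = Set.Ici (s / ρ) := Set.ext fun t ↦ (div_le_iff₀ hρ).symm
  calc ENNReal.ofReal s * ∫⁻ t in Set.Ioc 0 1, rayKernel n ρ s t
      ≤ ENNReal.ofReal s * ∫⁻ t in Set.Ici (s / ρ), ENNReal.ofReal (t ^ (n + 1))⁻¹ := by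
        change _ * ∫⁻ t in _, {t : ℝ | s ≤ t * ρ}.indicator _ t ≤ _
        rw [hset, lintegral_indicator measurableSet_Ici]
        gcongr
        exact Measure.restrict_le_self
    _ = ENNReal.ofReal (rayWeight n ρ s) := by
        rw [lintegral_Ici_inv_pow_succ hn (by positivity), ← ENNReal.ofReal_mul hs.le, rayWeight,
          div_pow, ← mul_pow_sub_one hn s]
        congr 1
        field_simp

theorem setLIntegral_closedBall_ray {G : E → ℝ≥0∞} (hG : Measurable G) {t : ℝ} (ht : 0 < t)
    (ρ : ℝ) : ∫⁻ x in Metric.closedBall 0 ρ, ‖x‖ₑ * G (t • x) ∂μ =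
      ∫⁻ y, ‖y‖ₑ * rayKernel (Module.finrank ℝ E) ρ ‖y‖ t * G y ∂μ := by
  have hnorm (x : E) : ‖x‖ₑ = ENNReal.ofReal t⁻¹ * ‖t • x‖ₑ := by
    rw [← ofReal_norm, ← ofReal_norm, ← ENNReal.ofReal_mul (inv_nonneg.2 ht.le), norm_smul,
      Real.norm_of_nonneg ht.le, inv_mul_cancel_left₀ ht.ne']
  rw [lintegral_congr fun x ↦ congrArg (· * G (t • x)) (hnorm x),
    setLIntegral_closedBall_comp_smul μ
      (G := fun y ↦ ENNReal.ofReal t⁻¹ * ‖y‖ₑ * G y) (by fun_prop) ht,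
    ← lintegral_const_mul _ (by fun_prop),
    ← lintegral_indicator Metric.isClosed_closedBall.measurableSet]
  refine lintegral_congr fun y ↦ ?_
  by_cases hy : ‖y‖ ≤ t * ρ
  · rw [Set.indicator_of_mem (mem_closedBall_zero_iff.2 hy), rayKernel,
      Set.indicator_of_mem (by exact hy), pow_succ, mul_inv, ENNReal.ofReal_mul (by positivity)]
    ring
  · rw [Set.indicator_of_notMem (mt mem_closedBall_zero_iff.1 hy), rayKernel,
      Set.indicator_of_notMem (by exact hy), mul_zero, zero_mul]

theorem lintegral_rays_le [Nontrivial E] {G : E → ℝ≥0∞} (hG : Measurable G) {ρ : ℝ}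
    (hρ : 0 < ρ) :
    ∫⁻ x in Metric.closedBall 0 ρ, (∫⁻ t in Set.Ioc (0 : ℝ) 1, ‖x‖ₑ * G (t • x)) ∂μ ≤
      ∫⁻ y, ENNReal.ofReal (rayWeight (Module.finrank ℝ E) ρ ‖y‖) * G y ∂μ := by
  have hkernel : Measurable fun p : ℝ × E ↦ rayKernel (Module.finrank ℝ E) ρ ‖p.2‖ p.1 :=
    (measurable_rayKernel _ ρ).comp (by fun_prop : Measurable fun p : ℝ × E ↦ (‖p.2‖, p.1))
  calc ∫⁻ x in Metric.closedBall 0 ρ, (∫⁻ t in Set.Ioc (0 : ℝ) 1, ‖x‖ₑ * G (t • x)) ∂μ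
      = ∫⁻ t in Set.Ioc (0 : ℝ) 1, ∫⁻ x in Metric.closedBall 0 ρ, ‖x‖ₑ * G (t • x) ∂μ :=
        lintegral_lintegral_swap (Measurable.aemeasurable (by fun_prop))
    _ = ∫⁻ t in Set.Ioc (0 : ℝ) 1,
          ∫⁻ y, ‖y‖ₑ * rayKernel (Module.finrank ℝ E) ρ ‖y‖ t * G y ∂μ :=
        setLIntegral_congr_fun measurableSet_Ioc fun _ ht ↦ setLIntegral_closedBall_ray μ hG ht.1 ρ
    _ = ∫⁻ y, (∫⁻ t in Set.Ioc (0 : ℝ) 1,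
          ‖y‖ₑ * rayKernel (Module.finrank ℝ E) ρ ‖y‖ t * G y) ∂μ :=
        lintegral_lintegral_swap (((measurable_snd.enorm.mul hkernel).mul
          (hG.comp measurable_snd)).aemeasurable)
    _ ≤ ∫⁻ y, ENNReal.ofReal (rayWeight (Module.finrank ℝ E) ρ ‖y‖) * G y ∂μ :=
        lintegral_mono fun y ↦ by
          have hy : Measurable (rayKernel (Module.finrank ℝ E) ρ ‖y‖) :=
            hkernel.comp measurable_prodMk_right
          rw [lintegral_mul_const _ (hy.const_mul _), lintegral_const_mul _ hy, ← ofReal_norm]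
          gcongr
          exact mul_lintegral_rayKernel_le Module.finrank_pos.ne' hρ (norm_nonneg y)

end RadialIntegration

section Cell

variable {E : Type*} [NormedAddCommGroup E] [NormedSpace ℝ E] [MeasurableSpace E] (μ : Measure E)

/-- The constant `κ` in the inequality `(∫_Q |f|)² ≤ κ ∫_Q |f'|²` for functions vanishing on the
ball of radius `r` about the centre of a cell `Q` of outer radius `ρ`. It is the integral of the
square of `rayWeight` over the points at distance between `r` and `ρ` from the centre. -/
def cellConst (r ρ : ℝ) : ℝ :=
  μ.real (Metric.ball 0 1) * ρ ^ (2 * Module.finrank ℝ E) / Module.finrank ℝ E *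
    ∫ s in Set.Icc r ρ, (s ^ (Module.finrank ℝ E - 1))⁻¹

theorem cellConst_nonneg {r : ℝ} (hr : 0 ≤ r) (ρ : ℝ) : 0 ≤ cellConst μ r ρ := by
  have hint : 0 ≤ ∫ s in Set.Icc r ρ, (s ^ (Module.finrank ℝ E - 1))⁻¹ :=
    setIntegral_nonneg measurableSet_Icc fun s hs ↦ inv_nonneg.2 (pow_nonneg (hr.trans hs.1) _)
  have hpow : 0 ≤ ρ ^ (2 * Module.finrank ℝ E) := (even_two_mul _).pow_nonneg ρ
  unfold cellConst
  positivity

theorem cellConst_mul [FiniteDimensional ℝ E] [Nontrivial E] {c : ℝ} (hc : 0 < c) (r ρ : ℝ) :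
    cellConst μ (c * r) (c * ρ) = c ^ (Module.finrank ℝ E + 2) * cellConst μ r ρ := by
  have hsub := Measure.setIntegral_comp_smul_of_pos volume
    (fun s : ℝ ↦ (s ^ (Module.finrank ℝ E - 1))⁻¹) (Set.Icc r ρ) hc
  rw [LinearOrderedField.smul_Icc hc, Module.finrank_self, pow_one, eq_inv_smul_iff₀ hc.ne',
    smul_eq_mul] at hsub
  simp only [smul_eq_mul, mul_pow, mul_inv, integral_const_mul] at hsub
  obtain ⟨n, hn⟩ : ∃ n, Module.finrank ℝ E = n + 1 :=
    Nat.exists_eq_add_one.2 Module.finrank_pos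
  rw [cellConst, cellConst, ← hsub, hn, Nat.add_sub_cancel]
  field_simp
  ring

variable [FiniteDimensional ℝ E] [Nontrivial E] [BorelSpace E] [μ.IsAddHaarMeasure]

theorem setIntegral_annulus_fun_norm {F : Type*}
    [NormedAddCommGroup F] [NormedSpace ℝ F] (k : ℝ → F) {r : ℝ} (hr : 0 < r) (ρ : ℝ) :
    ∫ y in Metric.closedBall 0 ρ \ Metric.ball 0 r, k ‖y‖ ∂μ =
      Module.finrank ℝ E • μ.real (Metric.ball 0 1) •
        ∫ s in Set.Icc r ρ, s ^ (Module.finrank ℝ E - 1) • k s := by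
  have hannulus : Metric.closedBall (0 : E) ρ \ Metric.ball 0 r = norm ⁻¹' Set.Icc r ρ := by
    ext y
    simp [and_comm]
  have hIcc : Set.Ioi 0 ∩ Set.Icc r ρ = Set.Icc r ρ :=
    Set.inter_eq_right.2 fun s hs ↦ hr.trans_le hs.1
  rw [hannulus, ← integral_indicator (measurable_norm measurableSet_Icc)]
  calc ∫ y, (norm ⁻¹' Set.Icc r ρ).indicator (fun y ↦ k ‖y‖) y ∂μ
      = ∫ y, (Set.Icc r ρ).indicator k ‖y‖ ∂μ := rfl
    _ = _ := by
      rw [integral_fun_norm_addHaar μ ((Set.Icc r ρ).indicator k)]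
      simp only [← Set.indicator_smul_apply (Set.Icc r ρ) (fun s ↦ s ^ (Module.finrank ℝ E - 1))]
      rw [setIntegral_indicator measurableSet_Icc, hIcc]

theorem lintegral_rayWeight_sq {r : ℝ} (hr : 0 < r) (ρ : ℝ) :
    ∫⁻ y in Metric.closedBall 0 ρ \ Metric.ball 0 r,
        ENNReal.ofReal (rayWeight (Module.finrank ℝ E) ρ ‖y‖) ^ 2 ∂μ =
      ENNReal.ofReal (cellConst μ r ρ) := by
  have hnorm {y : E} (hy : y ∈ Metric.closedBall 0 ρ \ Metric.ball 0 r) : r ≤ ‖y‖ ∧ ‖y‖ ≤ ρ :=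
    ⟨not_lt.1 (mt mem_ball_zero_iff.2 hy.2), mem_closedBall_zero_iff.1 hy.1⟩
  have hmeas : MeasurableSet (Metric.closedBall (0 : E) ρ \ Metric.ball 0 r) :=
    Metric.isClosed_closedBall.measurableSet.diff Metric.isOpen_ball.measurableSet
  have hsq : ∀ y ∈ Metric.closedBall (0 : E) ρ \ Metric.ball 0 r,
      ENNReal.ofReal (rayWeight (Module.finrank ℝ E) ρ ‖y‖) ^ 2 =
        ENNReal.ofReal (rayWeight (Module.finrank ℝ E) ρ ‖y‖ ^ 2) := fun y hy ↦ by
    have hρ : 0 ≤ ρ := (norm_nonneg y).trans (hnorm hy).2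
    exact (ENNReal.ofReal_pow (by unfold rayWeight; positivity) 2).symm
  have hint : IntegrableOn (fun y ↦ rayWeight (Module.finrank ℝ E) ρ ‖y‖ ^ 2)
      (Metric.closedBall (0 : E) ρ \ Metric.ball 0 r) μ := by
    refine ContinuousOn.integrableOn_compact
      ((isCompact_closedBall 0 ρ).diff Metric.isOpen_ball) ?_
    refine (continuousOn_const.mul (ContinuousOn.inv₀ (by fun_prop) fun y hy ↦ ?_)).pow 2
    exact pow_ne_zero _ (hr.trans_le (hnorm hy).1).ne'
  have hradial : ∀ s ∈ Set.Icc r ρ, s ^ (Module.finrank ℝ E - 1) •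
      rayWeight (Module.finrank ℝ E) ρ s ^ 2 =
        (ρ ^ Module.finrank ℝ E / Module.finrank ℝ E) ^ 2 *
          (s ^ (Module.finrank ℝ E - 1))⁻¹ := fun s hs ↦ by
    have : s ≠ 0 := (hr.trans_le hs.1).ne'
    rw [rayWeight, smul_eq_mul]
    field_simp
  have hdim : (Module.finrank ℝ E : ℝ) ≠ 0 := Nat.cast_ne_zero.2 Module.finrank_pos.ne'
  rw [setLIntegral_congr_fun hmeas hsq,
    ← ofReal_integral_eq_lintegral_ofReal hint (ae_of_all _ fun _ ↦ sq_nonneg _),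
    setIntegral_annulus_fun_norm μ (fun s ↦ rayWeight (Module.finrank ℝ E) ρ s ^ 2) hr,
    setIntegral_congr_fun measurableSet_Icc hradial, integral_const_mul, cellConst, nsmul_eq_mul,
    smul_eq_mul]
  congr 1
  field_simp
  ring

variable {F : Type*} [NormedAddCommGroup F] [NormedSpace ℝ F] {f : E → F}

theorem setLIntegral_le_of_starConvex_zero (hf : ContDiff ℝ 1 f) {r ρ : ℝ} (hr : 0 < r)
    (hρ : 0 < ρ) (hf0 : ∀ x ∈ Metric.closedBall 0 r, f x = 0) {Q : Set E} (hQ : MeasurableSet Q)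
    (hstar : StarConvex ℝ 0 Q) (hQρ : Q ⊆ Metric.closedBall 0 ρ) :
    ∫⁻ x in Q, ‖f x‖ₑ ∂μ ≤ ∫⁻ y in Q \ Metric.ball 0 r,
      ENNReal.ofReal (rayWeight (Module.finrank ℝ E) ρ ‖y‖) * ‖fderiv ℝ f y‖ₑ ∂μ := by
  have hderiv0 {y : E} (hy : y ∈ Metric.ball 0 r) : ‖fderiv ℝ f y‖ₑ = 0 := by
    have : f =ᶠ[𝓝 y] 0 := by
      filter_upwards [Metric.isOpen_ball.mem_nhds hy] with z hz
      exact hf0 z (Metric.ball_subset_closedBall hz)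
    rw [this.fderiv_eq, fderiv_zero, Pi.zero_apply, ← ofReal_norm, norm_zero, ENNReal.ofReal_zero]
  have hR : MeasurableSet (Q \ Metric.ball 0 r) := hQ.diff Metric.isOpen_ball.measurableSet
  let G : E → ℝ≥0∞ := (Q \ Metric.ball 0 r).indicator fun x ↦ ‖fderiv ℝ f x‖ₑ
  have hG : Measurable G := (hf.continuous_fderiv one_ne_zero).enorm.measurable.indicator hR
  have hGQ {y : E} (hy : y ∈ Q) : G y = ‖fderiv ℝ f y‖ₑ := by
    by_cases hyr : y ∈ Metric.ball 0 r
    · rw [hderiv0 hyr]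
      exact Set.indicator_of_notMem (fun h ↦ h.2 hyr) _
    · exact Set.indicator_of_mem (Set.mem_sdiff_of_mem hy hyr) _
  have hray {x : E} (hx : x ∈ Q) : ‖f x‖ₑ ≤ ∫⁻ t in Set.Ioc (0 : ℝ) 1, ‖x‖ₑ * G (t • x) := by
    have hle := enorm_sub_le_lintegral_fderiv hf 0 x
    simp only [zero_add, hf0 0 (Metric.mem_closedBall_self hr.le), sub_zero] at hle
    refine hle.trans_eq (setLIntegral_congr_fun measurableSet_Ioc fun t ht ↦ ?_)
    rw [hGQ (hstar.smul_mem hx ht.1.le ht.2)]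
  calc ∫⁻ x in Q, ‖f x‖ₑ ∂μ
      ≤ ∫⁻ x in Metric.closedBall 0 ρ, (∫⁻ t in Set.Ioc (0 : ℝ) 1, ‖x‖ₑ * G (t • x)) ∂μ :=
        (setLIntegral_mono' hQ fun x hx ↦ hray hx).trans (lintegral_mono_set hQρ)
    _ ≤ ∫⁻ y, ENNReal.ofReal (rayWeight (Module.finrank ℝ E) ρ ‖y‖) * G y ∂μ :=
        lintegral_rays_le μ hG hρ
    _ = _ := by
        rw [← lintegral_indicator hR]
        simp only [G, Set.indicator_mul_right]

theorem sq_setLIntegral_le_of_starConvex_zero (hf : ContDiff ℝ 1 f) {r ρ : ℝ} (hr : 0 < r)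
    (hρ : 0 < ρ) (hf0 : ∀ x ∈ Metric.closedBall 0 r, f x = 0) {Q : Set E} (hQ : MeasurableSet Q)
    (hstar : StarConvex ℝ 0 Q) (hQρ : Q ⊆ Metric.closedBall 0 ρ) :
    (∫⁻ x in Q, ‖f x‖ₑ ∂μ) ^ 2 ≤
      ENNReal.ofReal (cellConst μ r ρ) * ∫⁻ x in Q, ‖fderiv ℝ f x‖ₑ ^ 2 ∂μ := by
  have := hf.continuous_fderiv one_ne_zero
  refine (pow_le_pow_left' (setLIntegral_le_of_starConvex_zero μ hf hr hρ hf0 hQ hstar hQρ) 2).trans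
    ((sq_lintegral_mul_le ?_ (by fun_prop)).trans ?_)
  · exact Measurable.aemeasurable (by unfold rayWeight; fun_prop)
  · rw [← lintegral_rayWeight_sq μ hr]
    gcongr
    exact Set.sdiff_subset

theorem sq_setLIntegral_le_of_starConvex (hf : ContDiff ℝ 1 f) {c : E} {r ρ : ℝ} (hr : 0 < r)
    (hρ : 0 < ρ) (hf0 : ∀ x ∈ Metric.closedBall c r, f x = 0) {Q : Set E} (hQ : MeasurableSet Q)
    (hstar : StarConvex ℝ c Q) (hQρ : Q ⊆ Metric.closedBall c ρ) :
    (∫⁻ x in Q, ‖f x‖ₑ ∂μ) ^ 2 ≤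
      ENNReal.ofReal (cellConst μ r ρ) * ∫⁻ x in Q, ‖fderiv ℝ f x‖ₑ ^ 2 ∂μ := by
  have hmp : MeasurePreserving (· + c) μ μ := measurePreserving_add_right μ c
  have hme : MeasurableEmbedding (· + c) := measurableEmbedding_addRight c
  have hzero := sq_setLIntegral_le_of_starConvex_zero μ (f := fun x ↦ f (x + c)) (by fun_prop) hr hρ
    (fun x hx ↦ hf0 _ (by simpa using hx)) (hmp.measurable hQ)
    (StarConvex.preimage_add_left (by simpa using hstar)) fun x hx ↦ by simpa using hQρ hx
  simp only [fderiv_comp_add_right] at hzero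
  rwa [hmp.setLIntegral_comp_preimage_emb hme fun x ↦ ‖f x‖ₑ,
    hmp.setLIntegral_comp_preimage_emb hme fun x ↦ ‖fderiv ℝ f x‖ₑ ^ 2] at hzero

end Cell

section Grid

variable {d : ℕ}

theorem sq_setLIntegral_le_of_cells {X ι : Type*} [Fintype ι] [MeasurableSpace X] {μ : Measure X}
    {Q : ι → Set X} (hQ : ∀ i, MeasurableSet (Q i)) (hdisj : Pairwise (Function.onFun Disjoint Q))
    {Ω : Set X} (hΩ : Ω ⊆ ⋃ i, Q i) {u v : X → ℝ≥0∞} {κ : ℝ≥0∞}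
    (h : ∀ i, (∫⁻ x in Q i, u x ∂μ) ^ 2 ≤ κ * ∫⁻ x in Q i, v x ∂μ) :
    (∫⁻ x in Ω, u x ∂μ) ^ 2 ≤ Fintype.card ι * κ * ∫⁻ x, v x ∂μ := by
  have hsum (w : X → ℝ≥0∞) : ∫⁻ x in ⋃ i, Q i, w x ∂μ = ∑ i, ∫⁻ x in Q i, w x ∂μ := by
    rw [lintegral_iUnion hQ hdisj, tsum_fintype]
  have hcauchy := ENNReal.rpow_sum_le_const_mul_sum_rpow Finset.univ
    (fun i ↦ ∫⁻ x in Q i, u x ∂μ) one_le_two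
  norm_num at hcauchy
  calc (∫⁻ x in Ω, u x ∂μ) ^ 2 ≤ (∑ i, ∫⁻ x in Q i, u x ∂μ) ^ 2 := by
        rw [← hsum]
        gcongr
    _ ≤ Fintype.card ι * ∑ i, (∫⁻ x in Q i, u x ∂μ) ^ 2 := hcauchy
    _ ≤ Fintype.card ι * ∑ i, κ * ∫⁻ x in Q i, v x ∂μ := by
        gcongr with i
        exact h i
    _ = Fintype.card ι * κ * ∫⁻ x in ⋃ i, Q i, v x ∂μ := by
        rw [← Finset.mul_sum, hsum, mul_assoc]
    _ ≤ Fintype.card ι * κ * ∫⁻ x, v x ∂μ := by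
        gcongr
        exact Measure.restrict_le_self

theorem radius_pow [NeZero d] (α : ℝ) (m : ℕ) : radius d α (m ^ d) = (m : ℝ)⁻¹ * α := by
  rw [radius, Nat.cast_pow, ← Real.rpow_natCast_mul (Nat.cast_nonneg m),
    mul_div_cancel₀ _ (NeZero.ne _), Real.rpow_neg_one, mul_comm]

/-- The half-open cell of side `1 / m` with lower corner `k / m`, so that the cells with corners in
the closed-open unit cube partition it. -/
def gridCell (m : ℕ) (k : Fin d → Fin m) : Set (EuclideanSpace ℝ (Fin d)) :=
  {x | ∀ i, m * x i ∈ Set.Ico (k i : ℝ) (k i + 1)}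

/-- The centre of `gridCell m k`. -/
def gridCentre (m : ℕ) (k : Fin d → Fin m) : EuclideanSpace ℝ (Fin d) :=
  WithLp.toLp 2 fun i ↦ (m : ℝ)⁻¹ * (k i + 1 / 2)

theorem measurableSet_unitCube : MeasurableSet (unitCube d) := by
  simp only [unitCube, Set.ofPred_forall]
  exact .iInter fun i ↦ measurableSet_Ioo.preimage (by fun_prop)

theorem measurableSet_gridCell (m : ℕ) (k : Fin d → Fin m) : MeasurableSet (gridCell m k) := by
  simp only [gridCell, Set.ofPred_forall]
  exact .iInter fun i ↦ measurableSet_Ico.preimage (by fun_prop)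

theorem convex_gridCell (m : ℕ) (k : Fin d → Fin m) : Convex ℝ (gridCell m k) := by
  intro x hx y hy a b ha hb hab i
  convert convex_Ico _ _ (hx i) (hy i) ha hb hab using 1
  simp only [PiLp.add_apply, PiLp.smul_apply, smul_eq_mul]
  ring

theorem pairwise_disjoint_gridCell (m : ℕ) :
    Pairwise (Function.onFun Disjoint (gridCell (d := d) m)) := fun _ _ hkl ↦
  Set.disjoint_left.2 fun _ hk hl ↦ hkl <| funext fun i ↦ Fin.ext <|
    (Nat.floor_eq_on_Ico _ _ (hk i)).symm.trans (Nat.floor_eq_on_Ico _ _ (hl i))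

variable (m : ℕ) [NeZero m] (k : Fin d → Fin m)

theorem natCast_mul_gridCentre (i : Fin d) : m * gridCentre m k i = k i + 1 / 2 :=
  mul_inv_cancel_left₀ (NeZero.ne _) _

theorem gridCentre_mem_gridCell : gridCentre m k ∈ gridCell m k := fun i ↦ by
  rw [natCast_mul_gridCentre]
  constructor <;> linarith

theorem gridCell_subset_closedBall :
    gridCell m k ⊆ Metric.closedBall (gridCentre m k) ((m : ℝ)⁻¹ * (√d / 2)) := by
  intro x hx
  have hm : (0 : ℝ) < m := Nat.cast_pos.2 (NeZero.pos m)
  have hcoord (i : Fin d) : dist (x i) (gridCentre m k i) ≤ (m : ℝ)⁻¹ * (1 / 2) := by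
    rw [le_inv_mul_iff₀ hm, Real.dist_eq, ← abs_of_pos hm, ← abs_mul, mul_sub,
      natCast_mul_gridCentre, abs_le]
    constructor <;> linarith [(hx i).1, (hx i).2]
  rw [Metric.mem_closedBall, EuclideanSpace.dist_eq]
  refine Real.sqrt_le_iff.2 ⟨by positivity, ?_⟩
  calc ∑ i, dist (x i) (gridCentre m k i) ^ 2 ≤ ∑ _ : Fin d, ((m : ℝ)⁻¹ * (1 / 2)) ^ 2 := by
        gcongr with i
        exact hcoord i
    _ = ((m : ℝ)⁻¹ * (√d / 2)) ^ 2 := by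
        rw [Finset.sum_const, Finset.card_univ, Fintype.card_fin, nsmul_eq_mul, mul_pow, mul_pow,
          div_pow √(d : ℝ), Real.sq_sqrt (Nat.cast_nonneg d)]
        ring

theorem unitCube_subset_iUnion_gridCell : unitCube d ⊆ ⋃ k : Fin d → Fin m, gridCell m k := by
  intro x hx
  have hm : (0 : ℝ) < m := Nat.cast_pos.2 (NeZero.pos m)
  have hnonneg (i : Fin d) : 0 ≤ m * x i := mul_nonneg hm.le (hx i).1.le
  have hlt (i : Fin d) : ⌊m * x i⌋₊ < m :=
    (Nat.floor_lt (hnonneg i)).2 (mul_lt_of_lt_one_right hm (hx i).2)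
  exact Set.mem_iUnion.2 ⟨fun i ↦ ⟨⌊m * x i⌋₊, hlt i⟩,
    fun i ↦ ⟨Nat.floor_le (hnonneg i), Nat.lt_floor_add_one _⟩⟩

theorem gridCentre_mem_unitCube : gridCentre m k ∈ unitCube d := by
  intro i
  have hm : (0 : ℝ) < m := Nat.cast_pos.2 (NeZero.pos m)
  have hk : (k i : ℝ) + 1 ≤ m := by exact_mod_cast (k i).2
  have hcentre := natCast_mul_gridCentre m k i
  constructor
  · refine pos_of_mul_pos_right ?_ hm.le
    rw [hcentre]
    positivity
  · refine lt_of_mul_lt_mul_left ?_ hm.le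
    linarith

theorem isBounded_unitCube : Bornology.IsBounded (unitCube d) :=
  (Bornology.isBounded_iUnion.2 fun k ↦
    Metric.isBounded_closedBall.subset (gridCell_subset_closedBall 1 k)).subset
      (unitCube_subset_iUnion_gridCell 1)

variable {F : Type*} [NormedAddCommGroup F] [NormedSpace ℝ F]

theorem sq_setLIntegral_unitCube_le [NeZero d] {f : EuclideanSpace ℝ (Fin d) → F}
    (hf : ContDiff ℝ 1 f) {r : ℝ} (hr : 0 < r)
    (hf0 : ∀ k : Fin d → Fin m, ∀ x ∈ Metric.closedBall (gridCentre m k) r, f x = 0) :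
    (∫⁻ x in unitCube d, ‖f x‖ₑ) ^ 2 ≤
      ENNReal.ofReal (m ^ d * cellConst (volume : Measure (EuclideanSpace ℝ (Fin d))) r
        ((m : ℝ)⁻¹ * (√d / 2))) * ∫⁻ x, ‖fderiv ℝ f x‖ₑ ^ 2 := by
  have hρ : 0 < (m : ℝ)⁻¹ * (√d / 2) := by
    have hm : (0 : ℝ) < m := Nat.cast_pos.2 (NeZero.pos m)
    have hd : (0 : ℝ) < d := Nat.cast_pos.2 (NeZero.pos d)
    positivity
  refine (sq_setLIntegral_le_of_cells (measurableSet_gridCell m) (pairwise_disjoint_gridCell m)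
    (unitCube_subset_iUnion_gridCell m) fun k ↦
      sq_setLIntegral_le_of_starConvex volume hf hr hρ (hf0 k) (measurableSet_gridCell m k)
        ((convex_gridCell m k).starConvex (gridCentre_mem_gridCell m k))
        (gridCell_subset_closedBall m k)).trans_eq ?_
  rw [Fintype.card_fun, Fintype.card_fin, Fintype.card_fin, ENNReal.ofReal_mul (by positivity),
    ENNReal.ofReal_pow (Nat.cast_nonneg m), ENNReal.ofReal_natCast, Nat.cast_pow]

/-- The closed balls of radius `r` about the centres of the cells of the grid of side `1 / m` in the
unit cube, intersected with the closed cube as in `admissible`. -/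
def gridBalls (d m : ℕ) (r : ℝ) : Set (EuclideanSpace ℝ (Fin d)) :=
  closure (unitCube d) ∩ ⋃ k : Fin d → Fin m, Metric.closedBall (gridCentre m k) r

theorem gridBalls_mem_admissible [NeZero d] {α : ℝ} (hα : 0 < α) :
    gridBalls d m ((m : ℝ)⁻¹ * α) ∈ admissible α (m ^ d) (unitCube d) := by
  have hm : (0 : ℝ) < m := Nat.cast_pos.2 (NeZero.pos m)
  let e : Fin (m ^ d) ≃ (Fin d → Fin m) := (Fintype.equivFinOfCardEq (by simp)).symm
  refine ⟨gridCentre m ∘ e, fun i ↦ ?_, ?_⟩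
  · rw [radius_pow]
    exact Metric.self_subset_thickening (by positivity) _ (gridCentre_mem_unitCube m _)
  · rw [radius_pow, gridBalls]
    exact congrArg _ (e.iSup_comp (g := fun k ↦ Metric.closedBall (gridCentre m k) _)).symm

theorem compliance_gridBalls_le [NeZero d] {r : ℝ} (hr : 0 < r) :
    compliance (gridBalls d m r) (fun _ ↦ 1) (unitCube d) ≤
      (m ^ d * cellConst (volume : Measure (EuclideanSpace ℝ (Fin d))) r
        ((m : ℝ)⁻¹ * (√d / 2)) : ℝ) := by
  have hK : 0 ≤ m ^ d * cellConst (volume : Measure (EuclideanSpace ℝ (Fin d))) r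
      ((m : ℝ)⁻¹ * (√d / 2)) := mul_nonneg (by positivity) (cellConst_nonneg _ hr.le _)
  have : IsFiniteMeasure (volume.restrict (unitCube d)) :=
    isFiniteMeasure_restrict.2 isBounded_unitCube.measure_lt_top.ne
  refine compliance_le measurableSet_unitCube isBounded_unitCube (memLp_const 1) hK fun φ hφ ↦ ?_
  have hφ0 (k : Fin d → Fin m) (x) (hx : x ∈ Metric.closedBall (gridCentre m k) r) : φ x = 0 :=
    hφ.eq_zero_of_notMem fun hxU ↦
      hxU.2 ⟨subset_closure hxU.1, Set.mem_iUnion.2 ⟨k, hx⟩⟩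
  rw [← ENNReal.ofReal_le_ofReal_iff (mul_nonneg hK (integral_nonneg fun _ ↦ by positivity)),
    ENNReal.ofReal_mul hK, ofReal_integral_norm_sq hφ.memLp_gradient, ← sq_abs,
    ENNReal.ofReal_pow (abs_nonneg _), ← Real.norm_eq_abs, ofReal_norm]
  simp only [one_mul, ← ofReal_norm (gradient φ _), norm_gradient]
  simp only [ofReal_norm]
  exact (pow_le_pow_left' (enorm_integral_le_lintegral_enorm _) 2).trans
    (sq_setLIntegral_unitCube_le m hφ.contDiff_one hr hφ0)

end Grid

section Theta

variable {d : ℕ} {α : ℝ}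

theorem admissible_unitCube_nonempty (hα : 0 < α) {n : ℕ} (hn : 0 < n) :
    (admissible α n (unitCube d)).Nonempty := by
  have hr : 0 < radius d α n := mul_pos hα (Real.rpow_pos_of_pos (Nat.cast_pos.2 hn) _)
  exact ⟨_, fun _ ↦ gridCentre 1 0,
    fun _ ↦ Metric.self_subset_thickening hr _ (gridCentre_mem_unitCube 1 0), rfl⟩

theorem theta_le_of_frequently (hα : 0 < α) {b : EReal}
    (h : ∃ᶠ n : ℕ in atTop, ∃ S ∈ admissible α n (unitCube d),
      (((n : ℝ) ^ (2 / (d : ℝ)) : ℝ) : EReal) * compliance S (fun _ ↦ 1) (unitCube d) ≤ b) :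
    theta d α ≤ b := by
  have hchoice (n : ℕ) : ∃ S, (0 < n → S ∈ admissible α n (unitCube d)) ∧
      ((∃ S ∈ admissible α n (unitCube d),
        (((n : ℝ) ^ (2 / (d : ℝ)) : ℝ) : EReal) * compliance S (fun _ ↦ 1) (unitCube d) ≤ b) →
        (((n : ℝ) ^ (2 / (d : ℝ)) : ℝ) : EReal) * compliance S (fun _ ↦ 1) (unitCube d) ≤ b) := by
    by_cases hn : ∃ S ∈ admissible α n (unitCube d),
        (((n : ℝ) ^ (2 / (d : ℝ)) : ℝ) : EReal) * compliance S (fun _ ↦ 1) (unitCube d) ≤ b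
    · obtain ⟨S, hS, hle⟩ := hn
      exact ⟨S, fun _ ↦ hS, fun _ ↦ hle⟩
    · rcases n.eq_zero_or_pos with rfl | hpos
      · exact ⟨∅, fun h0 ↦ absurd h0 (lt_irrefl 0), fun h ↦ absurd h hn⟩
      · obtain ⟨S, hS⟩ := admissible_unitCube_nonempty (d := d) hα hpos
        exact ⟨S, fun _ ↦ hS, fun h ↦ absurd h hn⟩
  choose S hS hle using hchoice
  exact le_trans (sInf_le ⟨S, hS, rfl⟩) (liminf_le_of_frequently_le' (h.mono hle))

theorem theta_le_cellConst [NeZero d] (hα : 0 < α) :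
    theta d α ≤ (cellConst (volume : Measure (EuclideanSpace ℝ (Fin d))) α (√d / 2) : ℝ) := by
  refine theta_le_of_frequently hα (frequently_atTop.2 fun N ↦ ⟨(N + 1) ^ d,
    N.le_succ.trans (Nat.le_self_pow (NeZero.ne d) _), _, gridBalls_mem_admissible _ hα, ?_⟩)
  have hpow : (((N + 1) ^ d : ℕ) : ℝ) ^ (2 / (d : ℝ)) = (N + 1 : ℕ) ^ 2 := by
    rw [Nat.cast_pow, ← Real.rpow_natCast_mul (Nat.cast_nonneg _),
      mul_div_cancel₀ _ (NeZero.ne _), Real.rpow_two]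
  rw [hpow]
  refine (mul_le_mul_of_nonneg_left (compliance_gridBalls_le (N + 1) (by positivity))
    (EReal.coe_nonneg.2 (by positivity))).trans_eq ?_
  have hN : ((N + 1 : ℕ) : ℝ) ≠ 0 := Nat.cast_ne_zero.2 N.succ_ne_zero
  rw [← EReal.coe_mul, cellConst_mul _ (by positivity), finrank_euclideanSpace_fin, inv_pow,
    ← mul_assoc, ← mul_assoc, ← pow_add, add_comm 2, mul_inv_cancel₀ (pow_ne_zero _ hN), one_mul]

end Theta

section Constants

variable {E : Type*} [NormedAddCommGroup E] [NormedSpace ℝ E] [MeasurableSpace E] (μ : Measure E)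

theorem setIntegral_Icc_inv_pow_succ_le {n : ℕ} (hn : n ≠ 0) {r : ℝ} (hr : 0 < r) (ρ : ℝ) :
    ∫ s in Set.Icc r ρ, (s ^ (n + 1))⁻¹ ≤ (r ^ n)⁻¹ := by
  have hnonneg : 0 ≤ᵐ[volume.restrict (Set.Icc r ρ)] fun s : ℝ ↦ (s ^ (n + 1))⁻¹ :=
    (ae_restrict_iff' measurableSet_Icc).2 (ae_of_all _ fun s hs ↦
      inv_nonneg.2 (pow_nonneg (hr.le.trans hs.1) _))
  rw [integral_eq_lintegral_of_nonneg_ae hnonneg (by fun_prop)]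
  refine ENNReal.toReal_le_of_le_ofReal (by positivity) ?_
  calc ∫⁻ s in Set.Icc r ρ, ENNReal.ofReal (s ^ (n + 1))⁻¹
      ≤ ENNReal.ofReal ((r ^ n)⁻¹ / n) :=
        (lintegral_mono_set Set.Icc_subset_Ici_self).trans_eq (lintegral_Ici_inv_pow_succ hn hr)
    _ ≤ ENNReal.ofReal (r ^ n)⁻¹ := by
        gcongr
        exact div_le_self (by positivity) (Nat.one_le_cast.2 (Nat.one_le_iff_ne_zero.2 hn))

theorem setIntegral_Icc_inv {r ρ : ℝ} (hr : 0 < r) (hρ : 0 < ρ) :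
    ∫ s in Set.Icc r ρ, s⁻¹ = max 0 (Real.log (ρ / r)) := by
  rcases le_total r ρ with h | h
  · rw [integral_Icc_eq_integral_Ioc, ← intervalIntegral.integral_of_le h,
      integral_inv_of_pos hr hρ, max_eq_right (Real.log_nonneg ((one_le_div hr).2 h))]
  · rw [max_eq_left (Real.log_nonpos (by positivity) ((div_le_one hr).2 h)),
      setIntegral_measure_zero _ (by simp [h])]

theorem cellConst_le_zpow (hd : 3 ≤ Module.finrank ℝ E) {r : ℝ} (hr : 0 < r) (ρ : ℝ) :
    cellConst μ r ρ ≤ μ.real (Metric.ball 0 1) * ρ ^ (2 * Module.finrank ℝ E) /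
      Module.finrank ℝ E * r ^ (2 - (Module.finrank ℝ E : ℤ)) := by
  obtain ⟨n, hn⟩ : ∃ n, Module.finrank ℝ E = n + 2 := Nat.exists_eq_add_of_le' (by omega)
  have hpow : r ^ (2 - (Module.finrank ℝ E : ℤ)) = (r ^ n)⁻¹ := by
    rw [← zpow_natCast, ← zpow_neg, hn]
    congr 1
    push_cast
    ring
  have hρ : 0 ≤ ρ ^ (2 * Module.finrank ℝ E) := (even_two_mul _).pow_nonneg ρ
  rw [cellConst, hpow]
  gcongr
  rw [hn]
  exact setIntegral_Icc_inv_pow_succ_le (by omega) hr ρ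

theorem cellConst_eq_log (hd : Module.finrank ℝ E = 2) {r ρ : ℝ} (hr : 0 < r) (hρ : 0 < ρ) :
    cellConst μ r ρ = μ.real (Metric.ball 0 1) * ρ ^ (2 * Module.finrank ℝ E) /
      Module.finrank ℝ E * max 0 (Real.log (ρ / r)) := by
  rw [cellConst, ← setIntegral_Icc_inv hr hρ]
  simp only [hd, Nat.add_one_sub_one, pow_one]

end Constants

end OptimalCompliance

end

theorem proposition4p4 (d : ℕ) (hd : 2 ≤ d) :
    ∃ C : ℝ, ∀ α : ℝ, 0 < α →
      (3 ≤ d → OptimalCompliance.theta d α ≤ ((C * α ^ (2 - (d : ℤ)) : ℝ) : EReal)) ∧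
      (d = 2 → OptimalCompliance.theta d α ≤
        ((C * max 0 (Real.log ((Real.sqrt 2 * α)⁻¹)) : ℝ) : EReal)) := by
  have : NeZero d := ⟨by omega⟩
  refine ⟨volume.real (Metric.ball (0 : EuclideanSpace ℝ (Fin d)) 1) * (√d / 2) ^ (2 * d) / d,
    fun α hα ↦ ⟨fun h3 ↦ ?_, fun h2 ↦ ?_⟩⟩ <;>
    refine (OptimalCompliance.theta_le_cellConst hα).trans (EReal.coe_le_coe_iff.2 ?_)
  · simpa only [finrank_euclideanSpace_fin] using
      OptimalCompliance.cellConst_le_zpow (E := EuclideanSpace ℝ (Fin d)) volume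
        (by rwa [finrank_euclideanSpace_fin]) hα (√d / 2)
  · have hratio : √d / 2 / α = (√2 * α)⁻¹ := by
      rw [h2, Nat.cast_ofNat, Real.sqrt_div_self', one_div, mul_inv, div_eq_mul_inv]
    rw [OptimalCompliance.cellConst_eq_log volume (by rw [finrank_euclideanSpace_fin, h2]) hα
      (by positivity), hratio, finrank_euclideanSpace_fin]
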